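/- Fix a finite set $\pi$ of colour names. A \emph{PF-graph} (with palette $\pi$) is a finite directed graph $X$ with edge relation $E$ in which every vertex has at most one outgoing edge, together with the unary relation $\mathrm{Orphan}$ consisting of the vertices without outgoing edges and, for every colour name in $\pi$, a unary relation on the vertices. A \emph{function graph} is a PF-graph in which every vertex has exactly one outgoing edge. The \emph{Boolean associate} $\mathcal B(X)$ of a PF-graph $X$ is the Boolean algebra (with operations $0,1,\bar{\ },\cap,\cup$) of all sets of vertices of $X$, a vertex $x$ being identified with the atom $\{x\}$, together with the relations of $X$ ($E$, $\mathrm{Orphan}$ and the colours) as relations on the atoms of $\mathcal B(X)$, and an additional unary relation $\mathrm{Atomic}$ consisting of the atoms. For a first-order structure $M$ and $x_1,\dots,x_j\in M$, the \emph{$0$-theory} $th^0(M,x_1,\dots,x_j)$ is the set of atomic formulas $\varphi(v_1,\dots,v_j)$ (equalities of terms included) with $M\models\varphi(x_1,\dots,x_j)$, and the \emph{$(d+1)$-theory} is $th^{d+1}(M,x_1,\dots,x_j)=\{\,th^d(M,x_1,\dots,x_j,y) : y\in M\,\}$. The \emph{MSO $d$-theory} of a PF-graph $X$ is $Th^d(X)=th^d(\mathcal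 B(X))$. \textbf{Lemma.} There exists a computable function $F:\mathbb N\to\mathbb N$ (which may depend on the palette $\pi$) such that, for every $d\in\mathbb N$ and every function graph $X$ with palette $\pi$, there is a function graph $Y$ with palette $\pi$ and at most $F(d)$ vertices such that $Th^d(X)=Th^d(Y)$. -/

import Mathlib

universe u v w

/-- A coloured partial-function graph with palette `π` on the vertex type `V`: a directed graph in
which every vertex has at most one outgoing edge, together with one unary relation (a set of
vertices) for each colour. The unary relation `Orphan` is determined by the edges, see
`PFGraph.orphan`. -/
structure PFGraph (π : Type*) (V : Type*) extends Digraph V where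
  adj_unique : ∀ x y z : V, Adj x y → Adj x z → y = z
  color : π → Set V

/-- The unary relation `Orphan`: the vertices without outgoing edges. -/
def PFGraph.orphan {π V : Type*} (X : PFGraph π V) : Set V :=
  {x | ∀ y, ¬ X.Adj x y}

/-- A function graph is a partial-function graph where every vertex has exactly one outgoing
edge. -/
def PFGraph.IsFunctionGraph {π V : Type*} (X : PFGraph π V) : Prop :=
  ∀ x, ∃! y, X.Adj x y

/-- The operation symbols of Boolean algebras. -/
inductive BoolAssocFunctions : ℕ → Type
  | bot : BoolAssocFunctions 0
  | top : BoolAssocFunctions 0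
  | compl : BoolAssocFunctions 1
  | inf : BoolAssocFunctions 2
  | sup : BoolAssocFunctions 2

/-- The relation symbols of Boolean associates: the symbols `Orphan`, `E` and the colours of the
vocabulary of partial-function graphs, and the additional unary symbol `Atomic`. -/
inductive BoolAssocRelations (π : Type*) : ℕ → Type _
  | atomic : BoolAssocRelations π 1
  | orphan : BoolAssocRelations π 1
  | color (c : π) : BoolAssocRelations π 1
  | edge : BoolAssocRelations π 2

/-- The first-order vocabulary of Boolean associates of partial-function graphs. -/
def boolAssocLanguage (π : Type*) : FirstOrder.Language :=
  ⟨BoolAssocFunctions, BoolAssocRelations π⟩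

/-- The carrier of the Boolean associate of `X`: the Boolean algebra of all sets of vertices, a
vertex `x` being identified with the atom `{x}`. -/
def PFGraph.BoolAssoc {π V : Type*} (_X : PFGraph π V) : Type _ := Set V

instance PFGraph.boolAssocBooleanAlgebra {π V : Type*} (X : PFGraph π V) :
    BooleanAlgebra X.BoolAssoc :=
  inferInstanceAs (BooleanAlgebra (Set V))

/-- The Boolean associate of `X` as a first-order structure: the Boolean operations, the relations
of `X` transported to the atoms, and the set of all atoms. -/
instance PFGraph.boolAssocStructure {π V : Type*} (X : PFGraph π V) :
    (boolAssocLanguage π).Structure X.BoolAssoc where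
  funMap {n} f a :=
    match n, f, a with
    | _, BoolAssocFunctions.bot, _ => ⊥
    | _, BoolAssocFunctions.top, _ => ⊤
    | _, BoolAssocFunctions.compl, a => (a 0)ᶜ
    | _, BoolAssocFunctions.inf, a => a 0 ⊓ a 1
    | _, BoolAssocFunctions.sup, a => a 0 ⊔ a 1
  RelMap {n} R a :=
    match n, R, a with
    | _, BoolAssocRelations.atomic, a => ∃ x : V, a 0 = ({x} : Set V)
    | _, BoolAssocRelations.orphan, a => ∃ x ∈ X.orphan, a 0 = ({x} : Set V)
    | _, BoolAssocRelations.color c, a => ∃ x ∈ X.color c, a 0 = ({x} : Set V)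
    | _, BoolAssocRelations.edge, a =>
        ∃ x y : V, X.Adj x y ∧ a 0 = ({x} : Set V) ∧ a 1 = ({y} : Set V)

/-- The type of possible `d`-theories of `j`-tuples in the vocabulary `L`: sets of formulas in `j`
variables for `d = 0`, and sets of `d`-theories of `(j + 1)`-tuples for `d + 1`. -/
def FiniteTheory (L : FirstOrder.Language.{u, v}) : ℕ → ℕ → Type (max u v)
  | 0, j => Set (L.Formula (Fin j))
  | d + 1, j => Set (FiniteTheory L d (j + 1))

/-- The first-order `d`-theory `th^d(M, x₁, …, x_j)`: for `d = 0` it is the set of atomic formulas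
true at the tuple, and the `(d + 1)`-theory is the set of the `d`-theories of all extensions of the
tuple by one element of `M`. -/
def finiteTheory (L : FirstOrder.Language.{u, v}) {M : Type w} [L.Structure M] :
    (d : ℕ) → {j : ℕ} → (Fin j → M) → FiniteTheory L d j
  | 0, j, x => ({φ | φ.IsAtomic ∧ φ.Realize x} : Set (L.Formula (Fin j)))
  | d + 1, j, x =>
      (Set.range fun y : M => finiteTheory L d (Fin.snoc (α := fun _ => M) x y) :
        Set (FiniteTheory L d (j + 1)))

/-- The MSO `d`-theory of a partial-function graph: the first-order `d`-theory of its Boolean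
associate (with no distinguished elements). -/
def PFGraph.msoTheory {π V : Type*} (X : PFGraph π V) (d : ℕ) :
    FiniteTheory (boolAssocLanguage π) d 0 :=
  finiteTheory (boolAssocLanguage π) d (Fin.elim0 : Fin 0 → X.BoolAssoc)

/-! The proof is a composition argument. Monadic theories are recast as `coloredTheory`, where a
chosen set of vertices only refines a colouring. With finitely many colours there are finitely many
`d`-theories, and their number is computable in `d`. If two coloured digraphs are joined by edges
that depend only on the colours of their endpoints, the theory of the result depends only on the
theories of the two pieces (`coloredTheory_glue`).

Let `A k` be the set of theories realised on at most `2 ^ k` vertices. Gluing takes two members of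
`A k` into `A (k + 1)`. The sets increase inside a finite type, so `A k = A (k + 1)` for some `k` at
most the number of theories, and this `A k` is closed under gluing.

Every finite function graph is glued from single vertices with one fixed set of colours: split off
the component of a cycle vertex `r`, delete `r` to leave a forest, and peel the forest root by root.
Two extra bits of colour suffice: a mark on the target of `r`, and whether the outgoing edge stays
in the current piece. So its theory lies in `A k`, which bounds the size of an equivalent digraph.
Being a function graph is visible in the `2`-theory, so the argument is run at `d + 2`; finally,
equality of coloured theories gives equality of theories of Boolean associates. -/

/-- The type of `d`-theories of digraphs with vertices coloured by `C`. -/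
def ColoredTheory : ℕ → Type u → Type u
  | 0, C => Set C × Set (C × C) × Set (C × C)
  | d + 1, C => Set (ColoredTheory d (C × Prop))

/-- The monadic `d`-theory of the digraph `E` with colouring `c`. The `0`-theory records the colours
that occur, the pairs of colours of distinct vertices and the pairs of colours of edges; a set of
vertices is added to the structure by refining the colouring. -/
def coloredTheory : (d : ℕ) → {V : Type v} → {C : Type u} → (V → V → Prop) → (V → C) →
    ColoredTheory d C
  | 0, _, _, E, c =>
    (Set.range c, {p | ∃ x y, x ≠ y ∧ (c x, c y) = p}, {p | ∃ x y, E x y ∧ (c x, c y) = p})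
  | d + 1, V, C, E, c =>
    (Set.range fun A : V → Prop => coloredTheory d E (fun x => (c x, A x)) :
      Set (ColoredTheory d (C × Prop)))

/-! ### Back-and-forth properties of coloured theories -/

section transfer

variable {V : Type v} {W : Type w} {C : Type u}

theorem coloredTheory_zero_eq_iff {E : V → V → Prop} {E' : W → W → Prop} {c : V → C} {c' : W → C} :
    coloredTheory 0 E c = coloredTheory 0 E' c' ↔
      (∀ a, (∃ x, c x = a) ↔ ∃ x, c' x = a) ∧
      (∀ a b, (∃ x y, x ≠ y ∧ c x = a ∧ c y = b) ↔ ∃ x y, x ≠ y ∧ c' x = a ∧ c' y = b) ∧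
      (∀ a b, (∃ x y, E x y ∧ c x = a ∧ c y = b) ↔ ∃ x y, E' x y ∧ c' x = a ∧ c' y = b) := by
  change ((_, _, _) : Set C × Set (C × C) × Set (C × C)) = (_, _, _) ↔ _
  simp only [Prod.mk.injEq, Set.ext_iff, Set.mem_range, Set.mem_ofPred_eq, Prod.forall]

theorem coloredTheory_succ_eq {d : ℕ} {E : V → V → Prop} {E' : W → W → Prop} {c : V → C}
    {c' : W → C}
    (h₁ : ∀ A : V → Prop, ∃ B : W → Prop,
      coloredTheory d E (fun x => (c x, A x)) = coloredTheory d E' (fun x => (c' x, B x)))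
    (h₂ : ∀ B : W → Prop, ∃ A : V → Prop,
      coloredTheory d E (fun x => (c x, A x)) = coloredTheory d E' (fun x => (c' x, B x))) :
    coloredTheory (d + 1) E c = coloredTheory (d + 1) E' c' := by
  refine Set.Subset.antisymm ?_ ?_
  · rintro _ ⟨A, rfl⟩
    obtain ⟨B, hB⟩ := h₁ A
    exact ⟨B, hB.symm⟩
  · rintro _ ⟨B, rfl⟩
    obtain ⟨A, hA⟩ := h₂ B
    exact ⟨A, hA⟩

theorem exists_of_coloredTheory_succ_eq {d : ℕ} {E : V → V → Prop} {E' : W → W → Prop} {c : V → C}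
    {c' : W → C} (h : coloredTheory (d + 1) E c = coloredTheory (d + 1) E' c') (A : V → Prop) :
    ∃ B : W → Prop,
      coloredTheory d E (fun x => (c x, A x)) = coloredTheory d E' (fun x => (c' x, B x)) := by
  have h' : coloredTheory d E (fun x => (c x, A x)) ∈
      Set.range fun B : W → Prop => coloredTheory d E' (fun x => (c' x, B x)) := by
    have h'' : (Set.range fun A : V → Prop => coloredTheory d E (fun x => (c x, A x))) =
      Set.range fun B : W → Prop => coloredTheory d E' (fun x => (c' x, B x)) := h
    rw [← h'']
    exact ⟨A, rfl⟩
  obtain ⟨B, hB⟩ := h'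
  exact ⟨B, hB.symm⟩

theorem coloredTheory_congr_equiv (d : ℕ) (e : V ≃ W) {E : V → V → Prop} {E' : W → W → Prop}
    (hE : ∀ x y, E x y ↔ E' (e x) (e y)) :
    ∀ {C : Type u} {c : V → C} {c' : W → C}, (∀ x, c' (e x) = c x) →
      coloredTheory d E c = coloredTheory d E' c' := by
  induction d with
  | zero =>
    intro C c c' hc
    rw [coloredTheory_zero_eq_iff]
    simp [← e.exists_congr_right, hc, hE]
  | succ d ih =>
    intro C c c' hc
    refine coloredTheory_succ_eq (fun A => ⟨fun y => A (e.symm y), ih ?_⟩)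
      (fun B => ⟨fun x => B (e x), ih ?_⟩) <;> simp [hc]

/-- Merging colours only loses information: the occurring colours and pairs are pushed forward along
`g`, and a set that answers a move before merging still answers it afterwards. -/
theorem coloredTheory_recolor (d : ℕ) {E : V → V → Prop} {E' : W → W → Prop} :
    ∀ {C C' : Type u} {c : V → C} {c' : W → C} (g : C → C'),
      coloredTheory d E c = coloredTheory d E' c' →
      coloredTheory d E (fun x => g (c x)) = coloredTheory d E' (fun x => g (c' x)) := by
  induction d with
  | zero =>
    intro C C' c c' g h
    rw [coloredTheory_zero_eq_iff] at h ⊢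
    obtain ⟨h₁, h₂, h₃⟩ := h
    refine ⟨fun a => ⟨?_, ?_⟩, fun a b => ⟨?_, ?_⟩, fun a b => ⟨?_, ?_⟩⟩
    · rintro ⟨x, rfl⟩
      obtain ⟨y, hy⟩ := (h₁ _).1 ⟨x, rfl⟩
      exact ⟨y, by rw [hy]⟩
    · rintro ⟨x, rfl⟩
      obtain ⟨y, hy⟩ := (h₁ _).2 ⟨x, rfl⟩
      exact ⟨y, by rw [hy]⟩
    · rintro ⟨x, y, hxy, rfl, rfl⟩
      obtain ⟨x', y', h, hx, hy⟩ := (h₂ _ _).1 ⟨x, y, hxy, rfl, rfl⟩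
      exact ⟨x', y', h, by rw [hx], by rw [hy]⟩
    · rintro ⟨x, y, hxy, rfl, rfl⟩
      obtain ⟨x', y', h, hx, hy⟩ := (h₂ _ _).2 ⟨x, y, hxy, rfl, rfl⟩
      exact ⟨x', y', h, by rw [hx], by rw [hy]⟩
    · rintro ⟨x, y, hxy, rfl, rfl⟩
      obtain ⟨x', y', h, hx, hy⟩ := (h₃ _ _).1 ⟨x, y, hxy, rfl, rfl⟩
      exact ⟨x', y', h, by rw [hx], by rw [hy]⟩
    · rintro ⟨x, y, hxy, rfl, rfl⟩
      obtain ⟨x', y', h, hx, hy⟩ := (h₃ _ _).2 ⟨x, y, hxy, rfl, rfl⟩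
      exact ⟨x', y', h, by rw [hx], by rw [hy]⟩
  | succ d ih =>
    intro C C' c c' g h
    refine coloredTheory_succ_eq (fun A => ?_) (fun B => ?_)
    · obtain ⟨B, hB⟩ := exists_of_coloredTheory_succ_eq h A
      exact ⟨B, ih (fun p : C × Prop => (g p.1, p.2)) hB⟩
    · obtain ⟨A, hA⟩ := exists_of_coloredTheory_succ_eq h.symm B
      exact ⟨A, ih (fun p : C × Prop => (g p.1, p.2)) hA.symm⟩

theorem coloredTheory_eq_of_succ {d : ℕ} {E : V → V → Prop} {E' : W → W → Prop} {c : V → C}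
    {c' : W → C} (h : coloredTheory (d + 1) E c = coloredTheory (d + 1) E' c') :
    coloredTheory d E c = coloredTheory d E' c' := by
  -- Any set would do as the extra move, since the added mark is then forgotten by recolouring.
  obtain ⟨B, hB⟩ := exists_of_coloredTheory_succ_eq h (fun _ => False)
  exact coloredTheory_recolor d Prod.fst hB

theorem coloredTheory_eq_zero {d : ℕ} {E : V → V → Prop} {E' : W → W → Prop} {c : V → C}
    {c' : W → C} (h : coloredTheory d E c = coloredTheory d E' c') :
    coloredTheory 0 E c = coloredTheory 0 E' c' := by
  induction d with
  | zero => exact h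
  | succ d ih => exact ih (coloredTheory_eq_of_succ h)

end transfer

/-! ### Composition: the theory of a glued digraph -/

section glue

/-- The edges of the disjoint union of two coloured digraphs, where `R` and `S` are the pairs of
colours between which edges from left to right and from right to left are added. -/
def glueAdj {V₁ : Type v} {V₂ : Type w} {C : Type u} (E₁ : V₁ → V₁ → Prop) (c₁ : V₁ → C)
    (E₂ : V₂ → V₂ → Prop) (c₂ : V₂ → C) (R S : C → C → Prop) : V₁ ⊕ V₂ → V₁ ⊕ V₂ → Prop
  | .inl x, .inl y => E₁ x y
  | .inr x, .inr y => E₂ x y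
  | .inl x, .inr y => R (c₁ x) (c₂ y)
  | .inr x, .inl y => S (c₂ x) (c₁ y)

universe v₁ v₂ w₁ w₂

variable {V₁ : Type v₁} {V₂ : Type v₂} {W₁ : Type w₁} {W₂ : Type w₂}
  {E₁ : V₁ → V₁ → Prop} {E₂ : V₂ → V₂ → Prop} {E₁' : W₁ → W₁ → Prop} {E₂' : W₂ → W₂ → Prop}

theorem exists_sum_of_coloredTheory_zero_eq {C : Type u} {c₁ : V₁ → C} {c₂ : V₂ → C} {c₁' : W₁ → C}
    {c₂' : W₂ → C} (R S : C → C → Prop)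
    (h₁ : coloredTheory 0 E₁ c₁ = coloredTheory 0 E₁' c₁')
    (h₂ : coloredTheory 0 E₂ c₂ = coloredTheory 0 E₂' c₂') :
    (∀ x, ∃ x', Sum.map c₁ c₂ x = Sum.map c₁' c₂' x') ∧
    (∀ x y, x ≠ y → ∃ x' y', x' ≠ y' ∧ Sum.map c₁ c₂ x = Sum.map c₁' c₂' x' ∧
      Sum.map c₁ c₂ y = Sum.map c₁' c₂' y') ∧
    (∀ x y, glueAdj E₁ c₁ E₂ c₂ R S x y → ∃ x' y', glueAdj E₁' c₁' E₂' c₂' R S x' y' ∧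
      Sum.map c₁ c₂ x = Sum.map c₁' c₂' x' ∧ Sum.map c₁ c₂ y = Sum.map c₁' c₂' y') := by
  rw [coloredTheory_zero_eq_iff] at h₁ h₂
  have k₁ : ∀ x, ∃ x', c₁' x' = c₁ x := fun x => (h₁.1 _).1 ⟨x, rfl⟩
  have k₂ : ∀ x, ∃ x', c₂' x' = c₂ x := fun x => (h₂.1 _).1 ⟨x, rfl⟩
  refine ⟨?_, ?_, ?_⟩
  · rintro (x | x)
    · obtain ⟨x', hx⟩ := k₁ x
      exact ⟨.inl x', by simp [hx]⟩
    · obtain ⟨x', hx⟩ := k₂ x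
      exact ⟨.inr x', by simp [hx]⟩
  · rintro (x | x) (y | y) hxy
    · obtain ⟨x', y', h, hx, hy⟩ := (h₁.2.1 _ _).1 ⟨x, y, by simpa using hxy, rfl, rfl⟩
      exact ⟨.inl x', .inl y', by simpa using h, by simp [hx], by simp [hy]⟩
    · obtain ⟨x', hx⟩ := k₁ x
      obtain ⟨y', hy⟩ := k₂ y
      exact ⟨.inl x', .inr y', by simp, by simp [hx], by simp [hy]⟩
    · obtain ⟨x', hx⟩ := k₂ x
      obtain ⟨y', hy⟩ := k₁ y
      exact ⟨.inr x', .inl y', by simp, by simp [hx], by simp [hy]⟩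
    · obtain ⟨x', y', h, hx, hy⟩ := (h₂.2.1 _ _).1 ⟨x, y, by simpa using hxy, rfl, rfl⟩
      exact ⟨.inr x', .inr y', by simpa using h, by simp [hx], by simp [hy]⟩
  · rintro (x | x) (y | y) hxy
    · obtain ⟨x', y', h, hx, hy⟩ := (h₁.2.2 _ _).1 ⟨x, y, hxy, rfl, rfl⟩
      exact ⟨.inl x', .inl y', h, by simp [hx], by simp [hy]⟩
    · obtain ⟨x', hx⟩ := k₁ x
      obtain ⟨y', hy⟩ := k₂ y
      exact ⟨.inl x', .inr y', by simpa [glueAdj, hx, hy] using hxy, by simp [hx], by simp [hy]⟩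
    · obtain ⟨x', hx⟩ := k₂ x
      obtain ⟨y', hy⟩ := k₁ y
      exact ⟨.inr x', .inl y', by simpa [glueAdj, hx, hy] using hxy, by simp [hx], by simp [hy]⟩
    · obtain ⟨x', y', h, hx, hy⟩ := (h₂.2.2 _ _).1 ⟨x, y, hxy, rfl, rfl⟩
      exact ⟨.inr x', .inr y', h, by simp [hx], by simp [hy]⟩

/-- A set of vertices of the sum is a pair of sets, and each half is answered in its own piece.
Refining the colours keeps the old ones, so `R` and `S` still determine the cross edges. -/
theorem coloredTheory_glue (d : ℕ) :
    ∀ {C : Type u} {c₁ : V₁ → C} {c₂ : V₂ → C} {c₁' : W₁ → C} {c₂' : W₂ → C} (R S : C → C → Prop),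
      coloredTheory d E₁ c₁ = coloredTheory d E₁' c₁' →
      coloredTheory d E₂ c₂ = coloredTheory d E₂' c₂' →
      coloredTheory d (glueAdj E₁ c₁ E₂ c₂ R S) (Sum.map c₁ c₂) =
        coloredTheory d (glueAdj E₁' c₁' E₂' c₂' R S) (Sum.map c₁' c₂') := by
  induction d with
  | zero =>
    intro C c₁ c₂ c₁' c₂' R S h₁ h₂
    obtain ⟨a₁, a₂, a₃⟩ := exists_sum_of_coloredTheory_zero_eq R S h₁ h₂
    obtain ⟨b₁, b₂, b₃⟩ := exists_sum_of_coloredTheory_zero_eq R S h₁.symm h₂.symm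
    rw [coloredTheory_zero_eq_iff]
    refine ⟨fun a => ⟨?_, ?_⟩, fun a b => ⟨?_, ?_⟩, fun a b => ⟨?_, ?_⟩⟩
    · rintro ⟨x, rfl⟩
      obtain ⟨y, hy⟩ := a₁ x
      exact ⟨y, hy.symm⟩
    · rintro ⟨x, rfl⟩
      obtain ⟨y, hy⟩ := b₁ x
      exact ⟨y, hy.symm⟩
    · rintro ⟨x, y, hxy, rfl, rfl⟩
      obtain ⟨x', y', h, hx, hy⟩ := a₂ x y hxy
      exact ⟨x', y', h, hx.symm, hy.symm⟩
    · rintro ⟨x, y, hxy, rfl, rfl⟩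
      obtain ⟨x', y', h, hx, hy⟩ := b₂ x y hxy
      exact ⟨x', y', h, hx.symm, hy.symm⟩
    · rintro ⟨x, y, hxy, rfl, rfl⟩
      obtain ⟨x', y', h, hx, hy⟩ := a₃ x y hxy
      exact ⟨x', y', h, hx.symm, hy.symm⟩
    · rintro ⟨x, y, hxy, rfl, rfl⟩
      obtain ⟨x', y', h, hx, hy⟩ := b₃ x y hxy
      exact ⟨x', y', h, hx.symm, hy.symm⟩
  | succ d ih =>
    intro C c₁ c₂ c₁' c₂' R S h₁ h₂
    have key : ∀ (A₁ : V₁ → Prop) (A₂ : V₂ → Prop) (B₁ : W₁ → Prop) (B₂ : W₂ → Prop),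
        coloredTheory d E₁ (fun x => (c₁ x, A₁ x)) = coloredTheory d E₁' (fun x => (c₁' x, B₁ x)) →
        coloredTheory d E₂ (fun x => (c₂ x, A₂ x)) = coloredTheory d E₂' (fun x => (c₂' x, B₂ x)) →
        coloredTheory d (glueAdj E₁ c₁ E₂ c₂ R S)
            (fun x => (Sum.map c₁ c₂ x, Sum.elim A₁ A₂ x)) =
          coloredTheory d (glueAdj E₁' c₁' E₂' c₂' R S)
            (fun x => (Sum.map c₁' c₂' x, Sum.elim B₁ B₂ x)) := by
      intro A₁ A₂ B₁ B₂ k₁ k₂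
      -- The induction hypothesis tags the pair (colour, mark) with its side; recolouring moves the
      -- tag onto the colour alone.
      have := coloredTheory_recolor d
        (Sum.elim (fun p : C × Prop => ((Sum.inl p.1 : C ⊕ C), p.2)) (fun p => (Sum.inr p.1, p.2)))
        (ih (fun p q => R p.1 q.1) (fun p q => S p.1 q.1) k₁ k₂)
      convert this using 1
      · congr 1
        funext x
        rcases x with x | x <;> rfl
      · congr 1
        funext x
        rcases x with x | x <;> rfl
    refine coloredTheory_succ_eq (fun A => ?_) (fun B => ?_)
    · obtain ⟨B₁, hB₁⟩ := exists_of_coloredTheory_succ_eq h₁ (fun x => A (.inl x))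
      obtain ⟨B₂, hB₂⟩ := exists_of_coloredTheory_succ_eq h₂ (fun x => A (.inr x))
      refine ⟨Sum.elim B₁ B₂, ?_⟩
      rw [← key _ _ _ _ hB₁ hB₂]
      congr 1
      funext x
      rcases x with x | x <;> rfl
    · obtain ⟨A₁, hA₁⟩ := exists_of_coloredTheory_succ_eq h₁.symm (fun x => B (.inl x))
      obtain ⟨A₂, hA₂⟩ := exists_of_coloredTheory_succ_eq h₂.symm (fun x => B (.inr x))
      refine ⟨Sum.elim A₁ A₂, ?_⟩
      rw [key _ _ _ _ hA₁.symm hA₂.symm]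
      congr 1
      funext x
      rcases x with x | x <;> rfl

end glue

/-! ### Counting theories computably -/

/-- The number of `d`-theories of digraphs with `n` colours. -/
def numColoredTheory : ℕ → ℕ → ℕ
  | 0, n => 2 ^ n * (2 ^ (n * n) * 2 ^ (n * n))
  | d + 1, n => 2 ^ numColoredTheory d (n * 2)

theorem finite_coloredTheory_and_card (d : ℕ) : ∀ (C : Type u) [Finite C],
    Finite (ColoredTheory d C) ∧ Nat.card (ColoredTheory d C) = numColoredTheory d (Nat.card C) := by
  have card_set : ∀ (α : Type u) [Finite α], Nat.card (Set α) = 2 ^ Nat.card α := by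
    intro α _
    have := Fintype.ofFinite α
    rw [Nat.card_eq_fintype_card, Nat.card_eq_fintype_card, Fintype.card_set]
  induction d with
  | zero =>
    intro C _
    refine ⟨inferInstanceAs (Finite (Set C × Set (C × C) × Set (C × C))), ?_⟩
    change Nat.card (Set C × Set (C × C) × Set (C × C)) = _
    simp only [Nat.card_prod, card_set, numColoredTheory]
  | succ d ih =>
    intro C _
    obtain ⟨h₁, h₂⟩ := ih (C × Prop)
    refine ⟨inferInstanceAs (Finite (Set (ColoredTheory d (C × Prop)))), ?_⟩
    change Nat.card (Set (ColoredTheory d (C × Prop))) = _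
    rw [card_set, h₂, Nat.card_prod, numColoredTheory]
    simp

instance (d : ℕ) (C : Type u) [Finite C] : Finite (ColoredTheory d C) :=
  (finite_coloredTheory_and_card d C).1

/-- The recursion changes the parameter `n`; doing all the doublings first leaves a plain iteration,
which is visibly primitive recursive. -/
theorem numColoredTheory_eq_iterate (d n : ℕ) :
    numColoredTheory d n = (fun k => 2 ^ k)^[d] (numColoredTheory 0 (n * 2 ^ d)) := by
  induction d generalizing n with
  | zero => simp
  | succ d ih =>
    rw [Function.iterate_succ_apply', numColoredTheory.eq_2, ih, pow_succ, mul_assoc, mul_comm 2]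

theorem primrec_numColoredTheory (n : ℕ) : Primrec fun d => numColoredTheory d n := by
  have pow_two : Primrec fun k : ℕ => 2 ^ k :=
    (Primrec₂.unpaired'.1 Nat.Primrec.pow).comp (Primrec.const 2) Primrec.id
  have h : Primrec fun d => n * 2 ^ d := Primrec.nat_mul.comp (Primrec.const n) pow_two
  have h' : Primrec fun d => 2 ^ (n * 2 ^ d * (n * 2 ^ d)) := pow_two.comp (Primrec.nat_mul.comp h h)
  refine (Primrec.nat_iterate Primrec.id (Primrec.nat_mul.comp (pow_two.comp h)
    (Primrec.nat_mul.comp h' h')) (pow_two.comp Primrec.snd).to₂).of_eq fun d => ?_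
  rw [numColoredTheory_eq_iterate]
  rfl

theorem computable_two_pow_numColoredTheory (m n : ℕ) :
    Computable fun d => 2 ^ numColoredTheory (d + m) n :=
  ((Primrec₂.unpaired'.1 Nat.Primrec.pow).comp (Primrec.const 2) ((primrec_numColoredTheory n).comp
    (Primrec.nat_add.comp Primrec.id (Primrec.const m)))).to_comp

/-! ### Small theories and closure under gluing -/

/-- An increasing sequence of sets in a finite type becomes stationary at a step at most the
cardinality of the type. -/
theorem exists_eq_succ_of_monotone {T : Type u} [Finite T] {A : ℕ → Set T} (hA : Monotone A) :
    ∃ k ≤ Nat.card T, A k = A (k + 1) := by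
  by_contra! h
  -- If every step up to `Nat.card T` were strict, `A (Nat.card T + 1)` would have more elements
  -- than `T`.
  have key : ∀ k ≤ Nat.card T + 1, k ≤ (A k).ncard := by
    intro k
    induction k with
    | zero => simp
    | succ k ih =>
      intro hk
      have : (A k).ncard < (A (k + 1)).ncard :=
        Set.ncard_lt_ncard ((hA k.le_succ).ssubset_of_ne (h k (by omega)))
      have := ih (by omega)
      omega
  have := key _ le_rfl
  have := Set.ncard_le_card (A (Nat.card T + 1))
  omega

/-- The `d`-theories of coloured digraphs with at most `2 ^ k` vertices. -/
def smallTheories (d : ℕ) (C : Type u) (k : ℕ) : Set (ColoredTheory d C) :=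
  {t | ∃ n ≤ 2 ^ k, ∃ (E : Fin n → Fin n → Prop) (c : Fin n → C), coloredTheory d E c = t}

theorem monotone_smallTheories (d : ℕ) (C : Type u) : Monotone (smallTheories d C) := by
  rintro k l hkl _ ⟨n, hn, E, c, rfl⟩
  exact ⟨n, hn.trans (Nat.pow_le_pow_right two_pos hkl), E, c, rfl⟩

theorem mem_smallTheories {d k : ℕ} {V : Type v} [Finite V] {C : Type u} (h : Nat.card V ≤ 2 ^ k)
    (E : V → V → Prop) (c : V → C) : coloredTheory d E c ∈ smallTheories d C k := by
  let e := Finite.equivFin V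
  exact ⟨_, h, fun x y => E (e.symm x) (e.symm y), fun x => c (e.symm x),
    coloredTheory_congr_equiv d e.symm (fun _ _ => Iff.rfl) (fun _ => rfl)⟩

theorem glue_mem_smallTheories {d k : ℕ} {V₁ : Type v} {V₂ : Type w} {C C' : Type u}
    {E₁ : V₁ → V₁ → Prop} {c₁ : V₁ → C} {E₂ : V₂ → V₂ → Prop} {c₂ : V₂ → C} (R S : C → C → Prop)
    (g : C ⊕ C → C') (h₁ : coloredTheory d E₁ c₁ ∈ smallTheories d C k)
    (h₂ : coloredTheory d E₂ c₂ ∈ smallTheories d C k) :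
    coloredTheory d (glueAdj E₁ c₁ E₂ c₂ R S) (fun x => g (Sum.map c₁ c₂ x)) ∈
      smallTheories d C' (k + 1) := by
  obtain ⟨n, hn, E₁', c₁', h₁⟩ := h₁
  obtain ⟨m, hm, E₂', c₂', h₂⟩ := h₂
  rw [← coloredTheory_recolor d g (coloredTheory_glue d R S h₁ h₂)]
  refine mem_smallTheories ?_ _ _
  rw [Nat.card_sum, Nat.card_fin, Nat.card_fin, pow_succ]
  omega

/-- The `d`-theory of the subgraph induced on a set of vertices. -/
def inducedTheory (d : ℕ) {V : Type v} {C : Type u} (E : V → V → Prop) (c : V → C) (S : Set V) :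
    ColoredTheory d C :=
  coloredTheory d (fun x y : S => E x y) (fun x : S => c x)

/-- Gluing small replacements for the two pieces at most doubles the size bound, and by `hk`
doubling yields no new theory. The maps `g₁` and `g₂` update the colours from each piece to the
union. -/
theorem inducedTheory_union_mem {d k : ℕ} {V : Type v} {C : Type u}
    (hk : smallTheories d C k = smallTheories d C (k + 1)) {E : V → V → Prop}
    {c₁ c₂ c : V → C} {S₁ S₂ : Set V} (hS : Disjoint S₁ S₂) (R R' : C → C → Prop) (g₁ g₂ : C → C)
    (h₁ : inducedTheory d E c₁ S₁ ∈ smallTheories d C k)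
    (h₂ : inducedTheory d E c₂ S₂ ∈ smallTheories d C k)
    (hc₁ : ∀ x ∈ S₁, c x = g₁ (c₁ x)) (hc₂ : ∀ x ∈ S₂, c x = g₂ (c₂ x))
    (hR : ∀ x ∈ S₁, ∀ y ∈ S₂, E x y ↔ R (c₁ x) (c₂ y))
    (hR' : ∀ x ∈ S₁, ∀ y ∈ S₂, E y x ↔ R' (c₂ y) (c₁ x)) :
    inducedTheory d E c (S₁ ∪ S₂) ∈ smallTheories d C k := by
  classical
  rw [hk]
  have h := glue_mem_smallTheories R R' (Sum.elim g₁ g₂) h₁ h₂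
  rw [coloredTheory_congr_equiv d (Equiv.Set.union hS).symm (E' := fun x y : ↥(S₁ ∪ S₂) => E x y)
    (c' := fun x => c x) ?_ ?_] at h
  · exact h
  · rintro (x | x) (y | y) <;> simp [glueAdj, hR, hR']
  · rintro (x | x) <;> simp [hc₁, hc₂]

theorem inducedTheory_singleton_mem {d k : ℕ} {V : Type v} {C : Type u} (E : V → V → Prop)
    (c : V → C) (r : V) : inducedTheory d E c {r} ∈ smallTheories d C k :=
  mem_smallTheories (by simpa using Nat.one_le_two_pow) _ _

theorem inducedTheory_empty_mem {d k : ℕ} {V : Type v} {C : Type u} (E : V → V → Prop)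
    (c : V → C) : inducedTheory d E c ∅ ∈ smallTheories d C k :=
  mem_smallTheories (by simp) _ _

/-! ### Decomposing function graphs by peeling off vertices -/

section peeling

variable {V : Type v} {K : Type u} {d k : ℕ}

/-- Colours of the graph of `f` restricted to `S`: the colour given by `κ`, membership in the set of
marked vertices `U`, and whether the outgoing edge stays in `S`. -/
def peelColor (f : V → V) (κ : V → K) (U S : Set V) (x : V) : K × Prop × Prop :=
  (κ x, x ∈ U, f x ∈ S)

/-- The vertices from which `r` can be reached along edges of the graph of `f` restricted to `S`. -/
def reachSet (f : V → V) (S : Set V) (r : V) : Set V :=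
  {x | Relation.ReflTransGen (fun x y => x ∈ S ∧ y ∈ S ∧ f x = y) x r}

theorem mem_reachSet_self (f : V → V) (S : Set V) (r : V) : r ∈ reachSet f S r :=
  Relation.ReflTransGen.refl

theorem reachSet_subset {f : V → V} {S : Set V} {r : V} (hr : r ∈ S) : reachSet f S r ⊆ S := by
  intro x hx
  rcases Relation.ReflTransGen.cases_head hx with rfl | ⟨y, hy, -⟩
  exacts [hr, hy.1]

theorem apply_mem_reachSet {f : V → V} {S : Set V} {r x : V} (hx : x ∈ reachSet f S r)
    (hxr : x ≠ r) : f x ∈ reachSet f S r := by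
  rcases Relation.ReflTransGen.cases_head hx with rfl | ⟨y, hy, hyr⟩
  · exact absurd rfl hxr
  · rw [hy.2.2]
    exact hyr

theorem mem_reachSet_of_apply {f : V → V} {S : Set V} {r x : V} (hx : x ∈ S) (hfx : f x ∈ S)
    (h : f x ∈ reachSet f S r) : x ∈ reachSet f S r :=
  Relation.ReflTransGen.head ⟨hx, hfx, rfl⟩ h

/-- Gluing the vertices that reach `r` inside `S` to the remaining vertices of `S`. -/
theorem inducedTheory_mem_of_reachSet
    (hk : smallTheories d (K × Prop × Prop) k = smallTheories d (K × Prop × Prop) (k + 1))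
    {f : V → V} {κ : V → K} {U S : Set V} {r : V} (hr : r ∈ S)
    (hfr : f r ∈ S → f r ∈ reachSet f S r)
    (h₁ : inducedTheory d (f · = ·) (peelColor f κ U (reachSet f S r)) (reachSet f S r) ∈
      smallTheories d (K × Prop × Prop) k)
    (h₂ : inducedTheory d (f · = ·) (peelColor f κ U (S \ reachSet f S r)) (S \ reachSet f S r) ∈
      smallTheories d (K × Prop × Prop) k) :
    inducedTheory d (f · = ·) (peelColor f κ U S) S ∈ smallTheories d (K × Prop × Prop) k := by
  have hT := reachSet_subset (f := f) hr
  have key : ∀ x ∈ reachSet f S r, f x ∈ S → f x ∈ reachSet f S r := by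
    intro x hx hfx
    by_cases hxr : x = r
    · subst hxr
      exact hfr hfx
    · exact apply_mem_reachSet hx hxr
  have key' : ∀ x ∈ S \ reachSet f S r, f x ∈ S → f x ∉ reachSet f S r :=
    fun x hx hfx h => hx.2 (mem_reachSet_of_apply hx.1 hfx h)
  -- No edges run between the two parts, so for a vertex of either part "the edge stays in `S`" and
  -- "the edge stays in the part" agree, and colours are unchanged.
  have := inducedTheory_union_mem hk (c := peelColor f κ U S) Set.disjoint_sdiff_right
    (fun _ _ => False) (fun _ _ => False) id id h₁ h₂ ?_ ?_ ?_ ?_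
  · rwa [Set.union_sdiff_cancel hT] at this
  · intro x hx
    simp only [peelColor, id, Prod.mk.injEq, true_and, eq_iff_iff]
    exact ⟨key x hx, fun h => hT h⟩
  · intro x hx
    simp only [peelColor, id, Prod.mk.injEq, true_and, eq_iff_iff]
    exact ⟨fun h => ⟨h, key' x hx h⟩, fun h => h.1⟩
  · rintro x hx y hy
    simp only [iff_false]
    rintro rfl
    exact hy.2 (key x hx hy.1)
  · rintro x hx y hy
    simp only [iff_false]
    rintro rfl
    exact key' y hy (hT hx) hx

/-- Gluing `r` to the other vertices that reach `r`. Here `U` contains the vertices other than `r`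
to which there is an edge from `r`. -/
theorem inducedTheory_reachSet_mem
    (hk : smallTheories d (K × Prop × Prop) k = smallTheories d (K × Prop × Prop) (k + 1))
    {f : V → V} {κ : V → K} {U U' S : Set V} {r : V} (P : Prop → Prop) (Q : Prop)
    (hU' : ∀ x ∈ reachSet f S r \ {r}, (x ∈ U') = P (x ∈ U))
    (hQ : ∀ x ∈ reachSet f S r \ {r}, f r = x ↔ Q ∧ x ∈ U)
    (h : inducedTheory d (f · = ·) (peelColor f κ U (reachSet f S r \ {r})) (reachSet f S r \ {r}) ∈
      smallTheories d (K × Prop × Prop) k) :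
    inducedTheory d (f · = ·) (peelColor f κ U' (reachSet f S r)) (reachSet f S r) ∈
      smallTheories d (K × Prop × Prop) k := by
  -- The edges into `r` come exactly from the vertices whose edge leaves the piece without `r`; once
  -- `r` is back these edges stay inside, so that bit becomes `True`. Edges out of `r` go to marked
  -- vertices if `Q` holds. A loop at `r` is already in the singleton piece.
  have := inducedTheory_union_mem hk (c := peelColor f κ U' (reachSet f S r))
    Set.disjoint_sdiff_left (fun a _ => ¬ a.2.2) (fun _ a => Q ∧ a.2.1)
    (fun a => (a.1, P a.2.1, True)) id h
    (inducedTheory_singleton_mem (f · = ·) (peelColor f κ U' (reachSet f S r)) r) ?_ ?_ ?_ ?_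
  · rwa [Set.sdiff_union_of_subset (by simpa using mem_reachSet_self f S r)] at this
  · intro x hx
    simp only [peelColor, Prod.mk.injEq, true_and, eq_iff_iff, iff_true]
    exact ⟨by rw [hU' x hx], apply_mem_reachSet hx.1 hx.2⟩
  · intro x hx
    rfl
  · rintro x hx y rfl
    have := apply_mem_reachSet hx.1 hx.2
    simp [peelColor, this]
  · rintro x hx y rfl
    exact hQ x hx

/-- The graph of `f` on a set that every vertex eventually leaves. -/
theorem inducedTheory_forest_mem [Finite V]
    (hk : smallTheories d (K × Prop × Prop) k = smallTheories d (K × Prop × Prop) (k + 1))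
    (f : V → V) (κ : V → K) (U : Set V) : ∀ (n : ℕ) (S : Set V), S.ncard = n →
      (∀ x ∈ S, ∃ m, f^[m] x ∉ S) →
      inducedTheory d (f · = ·) (peelColor f κ U S) S ∈ smallTheories d (K × Prop × Prop) k := by
  intro n
  induction n using Nat.strong_induction_on with
  | _ n ih =>
  rintro S rfl hS
  rcases S.eq_empty_or_nonempty with rfl | ⟨x, hx⟩
  · exact inducedTheory_empty_mem _ _
  -- A root exists: otherwise `S` would be closed under `f` and no vertex could leave it.
  obtain ⟨r, hr, hfr⟩ : ∃ r ∈ S, f r ∉ S := by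
    by_contra! h
    obtain ⟨m, hm⟩ := hS x hx
    exact hm (Set.MapsTo.iterate (f := f) (s := S) h m hx)
  have step : ∀ T ⊆ S, r ∉ T →
      inducedTheory d (f · = ·) (peelColor f κ U T) T ∈ smallTheories d (K × Prop × Prop) k := by
    intro T hT hrT
    refine ih _ (Set.ncard_lt_ncard ⟨hT, fun h => hrT (h hr)⟩) T rfl fun x hx => ?_
    obtain ⟨m, hm⟩ := hS x (hT hx)
    exact ⟨m, fun h => hm (hT h)⟩
  have hT := reachSet_subset (f := f) hr
  -- The root has no edge inside `S`, hence `Q` is `False`; `P = id` preserves the marks needed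
  -- later to attach the cycle vertex.
  refine inducedTheory_mem_of_reachSet hk hr (fun h => absurd h hfr)
    (inducedTheory_reachSet_mem hk id False (fun _ _ => rfl) (fun x hx => ?_)
      (step _ (Set.sdiff_subset.trans hT) (by simp)))
    (step _ Set.sdiff_subset (by simp [mem_reachSet_self]))
  simp only [false_and, iff_false]
  rintro rfl
  exact hfr (hT hx.1)

/-- The graph of `f` on a set closed under `f`. -/
theorem inducedTheory_closed_mem [Finite V]
    (hk : smallTheories d (K × Prop × Prop) k = smallTheories d (K × Prop × Prop) (k + 1))
    (f : V → V) (κ : V → K) : ∀ (n : ℕ) (S : Set V), S.ncard = n → Set.MapsTo f S S →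
      inducedTheory d (f · = ·) (peelColor f κ ∅ S) S ∈ smallTheories d (K × Prop × Prop) k := by
  intro n
  induction n using Nat.strong_induction_on with
  | _ n ih =>
  rintro S rfl hS
  rcases S.eq_empty_or_nonempty with rfl | ⟨x, hx⟩
  · exact inducedTheory_empty_mem _ _
  -- By pigeonhole the orbit of `x` repeats, giving a periodic point; writing the period as `m + 1`
  -- makes it positive and shows that `f r` reaches `r`.
  obtain ⟨r, hr, m, hm⟩ : ∃ r ∈ S, ∃ m, f^[m + 1] r = r := by
    obtain ⟨i, j, hij, h⟩ := Finite.exists_ne_map_eq_of_infinite fun m => f^[m] x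
    wlog hlt : i < j generalizing i j
    · exact this j i hij.symm h.symm (by omega)
    refine ⟨f^[i] x, hS.iterate i hx, j - i - 1, ?_⟩
    rw [← Function.iterate_add_apply, show j - i - 1 + 1 + i = j by omega]
    exact h.symm
  have hT := reachSet_subset (f := f) hr
  have hfr : f r ∈ reachSet f S r := by
    have : ∀ l y, y ∈ S → f^[l] y = r → y ∈ reachSet f S r := by
      intro l
      induction l with
      | zero =>
        rintro y - rfl
        exact mem_reachSet_self _ _ _
      | succ l ihl =>
        intro y hy h
        exact mem_reachSet_of_apply hy (hS hy) (ihl _ (hS hy) h)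
    exact this m _ (hS hr) hm
  -- Without `r` its component is a forest. Only `f r` is marked there, to restore the edge out of
  -- `r`; the mark is then erased by the constant `P`.
  refine inducedTheory_mem_of_reachSet hk hr (fun _ => hfr)
    (inducedTheory_reachSet_mem hk (U := {f r}) (fun _ => False) True (fun _ _ => rfl)
      (fun x _ => by simp [eq_comm])
      (inducedTheory_forest_mem hk f κ _ _ _ rfl fun x hx => ?_))
    (ih _ (Set.ncard_lt_ncard ⟨Set.sdiff_subset, fun h => (h hr).2 (mem_reachSet_self _ _ _)⟩) _ rfl
      fun x hx => ⟨hS hx.1, fun h => hx.2 (mem_reachSet_of_apply hx.1 (hS hx.1) h)⟩)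
  -- A path to `r` must leave the component with `r` removed; the number of steps is found by
  -- induction along the path.
  have := hx.1
  induction this using Relation.ReflTransGen.head_induction_on with
  | refl => exact absurd rfl hx.2
  | head h₁ h₂ ih' =>
    rename_i a b
    by_cases hb : b = r
    · exact ⟨1, by simp [h₁.2.2, hb]⟩
    · obtain ⟨m, hm⟩ := ih' ⟨h₂, hb⟩
      exact ⟨m + 1, by rwa [Function.iterate_succ_apply, h₁.2.2]⟩

end peeling

-- From coloured theories to Boolean associates

universe u'
open FirstOrder Language

section translation

variable {π : Type u} {V : Type v} {W : Type w} {C : Type u'}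

/-- Being an atom is visible in the `0`-theory because it records the colour pairs of distinct
vertices: a second point would give such a pair inside `τ`. -/
theorem exists_preimage_eq_singleton {E : V → V → Prop} {E' : W → W → Prop} {c : V → C} {c' : W → C}
    (h : coloredTheory 0 E c = coloredTheory 0 E' c') {τ : Set C} {x : V} (hx : c ⁻¹' τ = {x}) :
    ∃ y, c' y = c x ∧ c' ⁻¹' τ = {y} := by
  rw [coloredTheory_zero_eq_iff] at h
  obtain ⟨y, hy⟩ := (h.1 _).1 ⟨x, rfl⟩
  have hxτ : c x ∈ τ := by
    change x ∈ c ⁻¹' τ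
    simp [hx]
  refine ⟨y, hy, Set.eq_singleton_iff_unique_mem.2 ⟨by simpa [hy] using hxτ, fun z hz => ?_⟩⟩
  by_contra hne
  obtain ⟨x₁, x₂, hne', h₁, h₂⟩ := (h.2.1 _ _).2 ⟨z, y, hne, rfl, rfl⟩
  have k₁ : x₁ ∈ c ⁻¹' τ := by simpa [h₁] using hz
  have k₂ : x₂ ∈ c ⁻¹' τ := by simpa [h₂, hy] using hxτ
  rw [hx] at k₁ k₂
  exact hne' (k₁.trans k₂.symm)

theorem preimage_eq_preimage_of_coloredTheory_eq {E : V → V → Prop} {E' : W → W → Prop} {c : V → C}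
    {c' : W → C} (h : coloredTheory 0 E c = coloredTheory 0 E' c') {τ₁ τ₂ : Set C}
    (hτ : c ⁻¹' τ₁ = c ⁻¹' τ₂) : c' ⁻¹' τ₁ = c' ⁻¹' τ₂ := by
  rw [coloredTheory_zero_eq_iff] at h
  ext y
  obtain ⟨x, hx⟩ := (h.1 _).2 ⟨y, rfl⟩
  have := Set.ext_iff.1 hτ x
  simpa [hx] using this

/-- The sets of vertices `c ⁻¹' α i` as a tuple of elements of the Boolean associate. -/
def PFGraph.preimageTuple (X : PFGraph π V) (c : V → C) {j : ℕ} (α : Fin j → Set C) :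
    Fin j → X.BoolAssoc :=
  fun i => (c ⁻¹' α i : Set V)

/-- This turns choosing one more element of the Boolean associate into refining the colouring, so
the two notions of theory can be compared by induction. -/
theorem PFGraph.snoc_preimageTuple (X : PFGraph π V) (c : V → C) {j : ℕ} (α : Fin j → Set C)
    (A : X.BoolAssoc) :
    (Fin.snoc (X.preimageTuple c α) A : Fin (j + 1) → X.BoolAssoc) =
      X.preimageTuple (fun x => (c x, x ∈ show Set V from A))
        (Fin.snoc (α := fun _ => Set (C × Prop)) (fun i => Prod.fst ⁻¹' α i) {p | p.2}) := by
  funext i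
  refine Fin.lastCases ?_ (fun i => ?_) i
  · simp only [Fin.snoc_last, preimageTuple]
    rfl
  · simp only [Fin.snoc_castSucc, preimageTuple]
    rfl

theorem exists_term_realize_eq_preimage (X : PFGraph π V) (Y : PFGraph π W) {c : V → C}
    {c' : W → C} {j : ℕ} (α : Fin j → Set C) (xs : Fin 0 → X.BoolAssoc) (ys : Fin 0 → Y.BoolAssoc)
    (t : (boolAssocLanguage π).Term (Fin j ⊕ Fin 0)) :
    ∃ τ : Set C,
      t.realize (Sum.elim (X.preimageTuple c α) xs) = (c ⁻¹' τ : Set V) ∧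
      t.realize (Sum.elim (Y.preimageTuple c' α) ys) =
        (c' ⁻¹' τ : Set W) := by
  induction t with
  | var i =>
    rcases i with i | i
    · exact ⟨α i, rfl, rfl⟩
    · exact i.elim0
  | func f ts ih =>
    choose τ h₁ h₂ using ih
    simp only [Term.realize_func, h₁, h₂]
    change BoolAssocFunctions _ at f
    cases f with
    | bot => exact ⟨∅, rfl, rfl⟩
    | top => exact ⟨Set.univ, rfl, rfl⟩
    | compl => exact ⟨(τ 0)ᶜ, rfl, rfl⟩
    | inf => exact ⟨τ 0 ∩ τ 1, rfl, rfl⟩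
    | sup => exact ⟨τ 0 ∪ τ 1, rfl, rfl⟩

theorem PFGraph.IsFunctionGraph.notMem_orphan {X : PFGraph π V} (hX : X.IsFunctionGraph) (x : V) :
    x ∉ X.orphan := fun h => by
  obtain ⟨y, hy, -⟩ := hX x
  exact h y hy

/-- Each term names the preimage of one set of colours, the same in both graphs, so atomic formulas
become statements about occurring colours and pairs. `Orphan` is not recorded, but never holds in
`X`. -/
theorem realize_of_coloredTheory_zero_eq {X : PFGraph π V} {Y : PFGraph π W}
    (hX : X.IsFunctionGraph) {c : V → C} {c' : W → C} {j : ℕ} (α : Fin j → Set C) (β : π → Set C)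
    (hβ : ∀ p, X.color p = c ⁻¹' β p) (hβ' : ∀ p, Y.color p = c' ⁻¹' β p)
    (h : coloredTheory 0 X.Adj c = coloredTheory 0 Y.Adj c')
    {φ : (boolAssocLanguage π).Formula (Fin j)} (hφ : φ.IsAtomic)
    (hr : φ.Realize (X.preimageTuple c α)) :
    φ.Realize (Y.preimageTuple c' α) := by
  unfold Formula.Realize at hr ⊢
  cases hφ with
  | equal t₁ t₂ =>
    rw [BoundedFormula.realize_bdEqual] at hr ⊢
    obtain ⟨τ₁, h₁, h₁'⟩ := exists_term_realize_eq_preimage X Y (c := c) (c' := c') α default default t₁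
    obtain ⟨τ₂, h₂, h₂'⟩ := exists_term_realize_eq_preimage X Y (c := c) (c' := c') α default default t₂
    rw [h₁, h₂] at hr
    rw [h₁', h₂']
    exact preimage_eq_preimage_of_coloredTheory_eq h hr
  | rel R ts =>
    rw [BoundedFormula.realize_rel] at hr ⊢
    choose τ h₁ h₂ using fun i =>
      exists_term_realize_eq_preimage X Y (c := c) (c' := c') α default default (ts i)
    simp only [h₁] at hr
    simp only [h₂]
    change BoolAssocRelations π _ at R
    cases R with
    | atomic =>
      obtain ⟨x, hx⟩ := hr
      obtain ⟨y, -, hy⟩ := exists_preimage_eq_singleton h hx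
      exact ⟨y, hy⟩
    | orphan =>
      obtain ⟨x, hx, -⟩ := hr
      exact absurd hx (hX.notMem_orphan x)
    | color p =>
      obtain ⟨x, hxp, hx⟩ := hr
      obtain ⟨y, hyx, hy⟩ := exists_preimage_eq_singleton h hx
      refine ⟨y, ?_, hy⟩
      rw [hβ] at hxp
      rw [hβ', Set.mem_preimage, hyx]
      exact hxp
    | edge =>
      obtain ⟨x₁, x₂, hadj, hx₁, hx₂⟩ := hr
      obtain ⟨y₁, hyx₁, hy₁⟩ := exists_preimage_eq_singleton h hx₁
      obtain ⟨y₂, hyx₂, hy₂⟩ := exists_preimage_eq_singleton h hx₂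
      obtain ⟨z₁, z₂, hz, hz₁, hz₂⟩ :=
        ((coloredTheory_zero_eq_iff.1 h).2.2 _ _).1 ⟨x₁, x₂, hadj, rfl, rfl⟩
      have k₁ : y₁ ∈ c' ⁻¹' τ 0 := hy₁ ▸ rfl
      have k₂ : y₂ ∈ c' ⁻¹' τ 1 := hy₂ ▸ rfl
      have l₁ : z₁ ∈ c' ⁻¹' τ 0 := by
        rw [Set.mem_preimage, hz₁, ← hyx₁]
        exact k₁
      have l₂ : z₂ ∈ c' ⁻¹' τ 1 := by
        rw [Set.mem_preimage, hz₂, ← hyx₂]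
        exact k₂
      rw [hy₁] at l₁
      rw [hy₂] at l₂
      rw [Set.mem_singleton_iff.1 l₁, Set.mem_singleton_iff.1 l₂] at hz
      exact ⟨y₁, y₂, hz, hy₁, hy₂⟩

theorem finiteTheory_eq_of_coloredTheory_eq {X : PFGraph π V} {Y : PFGraph π W}
    (hX : X.IsFunctionGraph) (hY : Y.IsFunctionGraph) (d : ℕ) :
    ∀ {C : Type u'} {c : V → C} {c' : W → C} {j : ℕ} (α : Fin j → Set C) (β : π → Set C),
      (∀ p, X.color p = c ⁻¹' β p) → (∀ p, Y.color p = c' ⁻¹' β p) →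
      coloredTheory d X.Adj c = coloredTheory d Y.Adj c' →
      finiteTheory (boolAssocLanguage π) d (X.preimageTuple c α) =
        finiteTheory (boolAssocLanguage π) d (Y.preimageTuple c' α) := by
  induction d with
  | zero =>
    intro C c c' j α β hβ hβ' h
    refine Set.Subset.antisymm ?_ ?_
    · rintro φ ⟨hφ, hr⟩
      exact ⟨hφ, realize_of_coloredTheory_zero_eq hX α β hβ hβ' h hφ hr⟩
    · rintro φ ⟨hφ, hr⟩
      exact ⟨hφ, realize_of_coloredTheory_zero_eq hY α β hβ' hβ h.symm hφ hr⟩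
  | succ d ih =>
    intro C c c' j α β hβ hβ' h
    have key : ∀ (A : X.BoolAssoc) (B : Y.BoolAssoc),
        coloredTheory d X.Adj (fun x => (c x, x ∈ show Set V from A)) =
          coloredTheory d Y.Adj (fun x => (c' x, x ∈ show Set W from B)) →
        finiteTheory (boolAssocLanguage π) d
            (Fin.snoc (α := fun _ => X.BoolAssoc) (X.preimageTuple c α) A) =
          finiteTheory (boolAssocLanguage π) d
            (Fin.snoc (α := fun _ => Y.BoolAssoc) (Y.preimageTuple c' α) B) := by
      intro A B hAB
      rw [X.snoc_preimageTuple, Y.snoc_preimageTuple]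
      exact ih _ (fun p => Prod.fst ⁻¹' β p) hβ hβ' hAB
    refine Set.Subset.antisymm ?_ ?_
    · rintro _ ⟨A, rfl⟩
      obtain ⟨B, hB⟩ := exists_of_coloredTheory_succ_eq h (fun x => x ∈ show Set V from A)
      exact ⟨({y | B y} : Set W), (key A ({y | B y} : Set W) hB).symm⟩
    · rintro _ ⟨B, rfl⟩
      obtain ⟨A, hA⟩ := exists_of_coloredTheory_succ_eq h.symm (fun x => x ∈ show Set W from B)
      exact ⟨({x | A x} : Set V), key ({x | A x} : Set V) B hA.symm⟩

/-- Being the graph of a function is determined by the `2`-theory. -/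
theorem existsUnique_of_coloredTheory_eq {d : ℕ} {E : V → V → Prop} {E' : W → W → Prop} {c : V → C}
    {c' : W → C} (hE : ∀ x, ∃! y, E x y)
    (h : coloredTheory (d + 2) E c = coloredTheory (d + 2) E' c') (y : W) : ∃! z, E' y z := by
  -- The two spare quantifiers mark `y` and a further vertex `z` by singletons, so that the
  -- `0`-theory can recognise both.
  obtain ⟨A, hA⟩ := exists_of_coloredTheory_succ_eq h.symm (· = y)
  have key : ∀ z, ∃ B : V → Prop, coloredTheory 0 E' (fun x => ((c' x, x = y), x = z)) =
      coloredTheory 0 E (fun x => ((c x, A x), B x)) := fun z => by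
    obtain ⟨B, hB⟩ := exists_of_coloredTheory_succ_eq hA (· = z)
    exact ⟨B, coloredTheory_eq_zero hB⟩
  refine existsUnique_of_exists_of_unique ?_ ?_
  -- Existence needs only the mark on `y`; the second mark is a filler.
  · obtain ⟨B, hB⟩ := key y
    rw [coloredTheory_zero_eq_iff] at hB
    obtain ⟨x, hx⟩ := (hB.1 _).1 ⟨y, rfl⟩
    obtain ⟨x', hx', -⟩ := hE x
    obtain ⟨y₁, y₂, hy, h₁, -⟩ := (hB.2.2 _ _).2 ⟨x, x', hx', rfl, rfl⟩
    rw [hx] at h₁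
    have : y₁ = y := by simpa using (Prod.ext_iff.1 (Prod.ext_iff.1 h₁).1).2
    exact ⟨y₂, this ▸ hy⟩
  · intro z₁ z₂ h₁ h₂
    obtain ⟨B, hB⟩ := key z₁
    rw [coloredTheory_zero_eq_iff] at hB
    obtain ⟨x₁, w₁, e₁, hx₁, hw₁⟩ := (hB.2.2 _ _).1 ⟨y, z₁, h₁, rfl, rfl⟩
    obtain ⟨x₂, w₂, e₂, hx₂, hw₂⟩ := (hB.2.2 _ _).1 ⟨y, z₂, h₂, rfl, rfl⟩
    -- Only `y` carries the first mark, so no two distinct vertices of `V` can both have its colour.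
    -- Then `w₁ = w₂`, so `z₂` has the colour of `z₁`, including its mark.
    have hx : x₁ = x₂ := by
      by_contra hne
      obtain ⟨y₁, y₂, hne', k₁, k₂⟩ := (hB.2.1 _ _).2 ⟨x₁, x₂, hne, hx₁, hx₂⟩
      have k₁ : y₁ = y := by simpa using (Prod.ext_iff.1 (Prod.ext_iff.1 k₁).1).2
      have k₂ : y₂ = y := by simpa using (Prod.ext_iff.1 (Prod.ext_iff.1 k₂).1).2
      exact hne' (k₁.trans k₂.symm)
    have hw : w₁ = w₂ := (hE x₁).unique e₁ (hx ▸ e₂)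
    have := hw₁.symm.trans ((congrArg (fun x => ((c x, A x), B x)) hw).trans hw₂)
    simpa [eq_comm] using (Prod.ext_iff.1 this).2

end translation

/-! ### The main theorem -/

theorem mainTheorem3 {π : Type*} [Finite π] :
    ∃ F : ℕ → ℕ, Computable F ∧
      ∀ (d : ℕ) {V : Type*} [Finite V] (X : PFGraph π V), X.IsFunctionGraph →
        ∃ (W : Type) (_ : Finite W) (Y : PFGraph π W), Y.IsFunctionGraph ∧
          Nat.card W ≤ F d ∧ X.msoTheory d = Y.msoTheory d := by
  -- The shift by `2` pays for recognising function graphs; the colours are the palette together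
  -- with the two peeling bits.
  refine ⟨_, computable_two_pow_numColoredTheory 2 (Nat.card ((π → Prop) × Prop × Prop)),
    fun d V _ X hX => ?_⟩
  obtain ⟨k, hk, hA⟩ :=
    exists_eq_succ_of_monotone (monotone_smallTheories (d + 2) ((π → Prop) × Prop × Prop))
  rw [(finite_coloredTheory_and_card _ _).2] at hk
  choose f hf using fun x => (hX x).exists
  have hadj : X.Adj = (f · = ·) := by
    funext x y
    exact propext ⟨fun h => X.adj_unique x _ _ (hf x) h, fun h => h ▸ hf x⟩
  let c := peelColor f (fun x p => x ∈ X.color p) ∅ Set.univ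
  have hmem : coloredTheory (d + 2) X.Adj c ∈ smallTheories (d + 2) ((π → Prop) × Prop × Prop) k := by
    have h := inducedTheory_closed_mem hA f (fun x p => x ∈ X.color p) _ Set.univ rfl
      (Set.mapsTo_univ _ _)
    rw [hadj]
    rwa [inducedTheory, coloredTheory_congr_equiv _ (Equiv.Set.univ V)
      (E := fun x y : Set.univ => f x = y)
      (E' := (f · = ·)) (c := fun x : Set.univ => c x) (c' := c) (fun _ _ => Iff.rfl)
      (fun _ => rfl)] at h
  obtain ⟨n, hn, E, c', h⟩ := hmem
  have hE := existsUnique_of_coloredTheory_eq hX h.symm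
  let Y : PFGraph π (Fin n) :=
    { Adj := E
      adj_unique := fun x _ _ h₁ h₂ => (hE x).unique h₁ h₂
      color := fun p => {y | (c' y).1 p} }
  refine ⟨Fin n, inferInstance, Y, hE, ?_, ?_⟩
  · simpa using hn.trans (Nat.pow_le_pow_right two_pos hk)
  · have h' : coloredTheory d X.Adj c = coloredTheory d Y.Adj c' :=
      coloredTheory_eq_of_succ (coloredTheory_eq_of_succ h.symm)
    have := finiteTheory_eq_of_coloredTheory_eq (Y := Y) hX hE d (Fin.elim0 : Fin 0 → Set _)
      (fun p => {a | a.1 p}) (fun _ => rfl) (fun _ => rfl) h'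
    unfold PFGraph.msoTheory
    convert this using 2
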